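/- Let $\mathbb{T}=\mathbb{R}/\mathbb{Z}$, and for $x\in\mathbb{T}$ let $|x|$ denote the distance from $x$ to $0$ in $\mathbb{T}$. A sequence $(y_n)_{n\ge 1}$ in $\mathbb{T}$ has \emph{Poissonian pair correlation} if for all $s>0$ $$\lim_{N\to\infty}\frac1N\#\Big\{1\le m\ne n\le N : |y_m-y_n|\le \frac sN\Big\}=2s,$$ and it has \emph{Poissonian correlation of four-fold differences} if for all $s>0$ $$\lim_{N\to\infty}\frac1{N^2}\#\Big\{1\le m,n,k,l\le N,\ \{m,n\}\ne\{k,l\} : |y_m+y_n-y_k-y_l|\le \frac s{N^2}\Big\}=2s.$$ Let $x_1,x_2,\dots$ be independent random variables, each uniformly distributed on $\mathbb{T}$, and let $(y_n)_{n\ge1}=(x_1,-x_1,x_2,-x_2,\dots)$. Then almost surely $(y_n)$ has Poissonian pair correlation. On the other hand, $(y_n)$ never (that is, for no outcome) has Poissonian correlation of four-fold differences; moreover, for every outcome and every $N\ne 3$, $$\#\big\{1\le m,n,k,l\le N,\ \{m,n\}\neq\{k,l\} : y_m+y_n-y_k-y_l=0\big\}\ \ge\ \frac{N^2}{4}-\frac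 N2 .$$ -/

import Mathlib

open Filter Topology MeasureTheory ProbabilityTheory

/-- Poissonian pair correlation of a sequence on the torus `ℝ / ℤ`. The sequence is indexed from
`0`, so that the first `N` terms are those with index in `Fin N`; the norm of `UnitAddCircle` is the
distance to the nearest integer. -/
def HasPoissonianPairCorrelation (y : ℕ → UnitAddCircle) : Prop :=
  ∀ s : ℝ, 0 < s →
    Tendsto
      (fun N : ℕ =>
        (1 / (N : ℝ)) *
          (({p : Fin N × Fin N | p.1 ≠ p.2 ∧ ‖y p.1 - y p.2‖ ≤ s / (N : ℝ)}.ncard : ℕ) : ℝ))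
      atTop (𝓝 (2 * s))

/-- The pairs `(a, b)` of `k`-tuples of indices among the first `N` ones, such that
`{a_1, …, a_k} ≠ {b_1, …, b_k}` as multisets. -/
def nontrivialIndexPairs (k N : ℕ) : Set ((Fin k → Fin N) × (Fin k → Fin N)) :=
  {p | Multiset.map p.1 Finset.univ.val ≠ Multiset.map p.2 Finset.univ.val}

/-- The `2k`-fold difference `∑ j, y_{a_j} - ∑ j, y_{b_j}` at a pair of `k`-tuples of indices. -/
noncomputable def multiDifference (y : ℕ → UnitAddCircle) {k N : ℕ}
    (p : (Fin k → Fin N) × (Fin k → Fin N)) : UnitAddCircle :=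
  ∑ j, y (p.1 j) - ∑ j, y (p.2 j)

/-- Poissonian correlation of `2k`-fold differences of a sequence on the torus. -/
def HasPoissonianCorrelationOfDifferences (k : ℕ) (y : ℕ → UnitAddCircle) : Prop :=
  ∀ s : ℝ, 0 < s →
    Tendsto
      (fun N : ℕ =>
        (1 / (N : ℝ) ^ k) *
          (({p ∈ nontrivialIndexPairs k N | ‖multiDifference y p‖ ≤ s / (N : ℝ) ^ k}.ncard : ℕ) : ℝ))
      atTop (𝓝 (2 * s))

/-- The sequence `(x_1, -x_1, x_2, -x_2, …)`. -/
noncomputable def signedDoubling (x : ℕ → UnitAddCircle) (n : ℕ) : UnitAddCircle :=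
  if n % 2 = 0 then x (n / 2) else -x (n / 2)

/-! Pair correlation is a second-moment argument. For indices `m ≠ n`, the difference `y m - y n` is
an integer combination of the `X e` with some nonzero coefficient, so it is uniform: multiplication
by a nonzero integer preserves Haar measure on the circle, even for the coefficient `±2` that the
pair `x, -x` produces. Closeness events of two index pairs are independent as soon as the unordered
pairs of blocks `n / 2` differ (`measure_closeEvent_inter`), so each event is correlated with at
most 8 others. Hence the number of close pairs has variance `O(N)`; after division by `N` this is
summable along `N = k ^ 2`, giving almost sure convergence there, and monotonicity fills the gaps
(`tendsto_div_of_tendsto_sq`).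

Four-fold differences fail deterministically: `x + (-x) = 0` in every block, so any two distinct
blocks give a nontrivial zero. There are of order `N ^ 2` of these, which is too many for small `s`.
-/

/-- The sign with which `x (m / 2)` enters the `m`-th term of `signedDoubling x`. -/
def doublingSign (m : ℕ) : ℤ := if m % 2 = 0 then 1 else -1

lemma signedDoubling_eq_zsmul (x : ℕ → UnitAddCircle) (m : ℕ) :
    signedDoubling x m = doublingSign m • x (m / 2) := by
  unfold signedDoubling doublingSign
  split_ifs <;> simp

/-- The coefficient of `x e` in the `m`-th term of `signedDoubling x`. -/
def doublingCoeff (e m : ℕ) : ℤ := if m / 2 = e then doublingSign m else 0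

/-- The difference is `±1` if only one index lies in block `e`, and `±2` if both do, since their
signs are then opposite. -/
lemma doublingCoeff_sub_ne_zero {e m n : ℕ} (hmn : m ≠ n) (he : m / 2 = e ∨ n / 2 = e) :
    doublingCoeff e m - doublingCoeff e n ≠ 0 := by
  unfold doublingCoeff doublingSign
  split_ifs <;> omega

lemma signedDoubling_eq_add_update (x : ℕ → UnitAddCircle) (e m : ℕ) :
    signedDoubling x m =
      doublingCoeff e m • x e + signedDoubling (Function.update x e 0) m := by
  rw [signedDoubling_eq_zsmul, signedDoubling_eq_zsmul, doublingCoeff]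
  by_cases h : m / 2 = e
  · simp [h]
  · simp [h]

lemma signedDoubling_congr {x x' : ℕ → UnitAddCircle} {m : ℕ} (h : x (m / 2) = x' (m / 2)) :
    signedDoubling x m = signedDoubling x' m := by
  rw [signedDoubling_eq_zsmul, signedDoubling_eq_zsmul, h]

/-- Adding an independent uniform variable produces a variable that is uniform and independent. -/
lemma measure_add_closedBall_inter {Ω γ : Type*} [MeasurableSpace Ω] [MeasurableSpace γ]
    {μ : Measure Ω} [IsProbabilityMeasure μ] {U : Ω → UnitAddCircle} {Z : Ω → γ}
    (hU : Measurable U) (hZ : Measurable Z) (hlaw : μ.map U = volume) (hind : IndepFun U Z μ)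
    {w : γ → UnitAddCircle} (hw : Measurable w) {B : Set γ} (hB : MeasurableSet B) (r : ℝ) :
    μ ({ω | ‖U ω + w (Z ω)‖ ≤ r} ∩ Z ⁻¹' B) = ENNReal.ofReal (min 1 (2 * r)) * μ (Z ⁻¹' B) := by
  have hS : MeasurableSet {q : UnitAddCircle × γ | ‖q.1 + w q.2‖ ≤ r ∧ q.2 ∈ B} :=
    by
    have h : Measurable fun q : UnitAddCircle × γ => ‖q.1 + w q.2‖ := by fun_prop
    exact (measurableSet_le h measurable_const).inter (measurable_snd hB)
  have h1 := (indepFun_iff_map_prod_eq_prod_map_map hU.aemeasurable hZ.aemeasurable).1 hind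
  have h2 : μ ({ω | ‖U ω + w (Z ω)‖ ≤ r} ∩ Z ⁻¹' B) =
      μ.map (fun ω => (U ω, Z ω)) {q : UnitAddCircle × γ | ‖q.1 + w q.2‖ ≤ r ∧ q.2 ∈ B} := by
    rw [Measure.map_apply (hU.prodMk hZ) hS]; rfl
  have : IsProbabilityMeasure (μ.map Z) := Measure.isProbabilityMeasure_map hZ.aemeasurable
  rw [h2, h1, hlaw, Measure.prod_apply_symm hS]
  have h3 : ∀ z, volume ((fun u => (u, z)) ⁻¹'
      {q : UnitAddCircle × γ | ‖q.1 + w q.2‖ ≤ r ∧ q.2 ∈ B}) =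
      B.indicator (fun _ => ENNReal.ofReal (min 1 (2 * r))) z := by
    intro z
    by_cases hz : z ∈ B
    · rw [Set.indicator_of_mem hz, ← AddCircle.volume_closedBall (x := -w z)]
      congr 1
      ext u
      simp [hz, dist_eq_norm]
    · simp [hz]
  simp_rw [h3]
  rw [lintegral_indicator hB, setLIntegral_const, Measure.map_apply hZ hB]

/-! ### Uniformity and pairwise independence of the closeness events -/

section
variable {Ω : Type*} [MeasurableSpace Ω] {μ : Measure Ω} [IsProbabilityMeasure μ]
  {X : ℕ → Ω → UnitAddCircle}

/-- The event that two terms of the sequence `signedDoubling` are `r`-close. -/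
def closeEvent (X : ℕ → Ω → UnitAddCircle) (r : ℝ) (p : ℕ × ℕ) : Set Ω :=
  {ω | ‖signedDoubling (fun n => X n ω) p.1 - signedDoubling (fun n => X n ω) p.2‖ ≤ r}

lemma measurable_signedDoubling {γ : Type*} [MeasurableSpace γ] {X : ℕ → γ → UnitAddCircle}
    (hX : ∀ n, Measurable (X n)) (m : ℕ) :
    Measurable fun ω => signedDoubling (fun n => X n ω) m := by
  simp_rw [signedDoubling_eq_zsmul]
  exact (continuous_zsmul _).measurable.comp (hX _)

lemma measurableSet_closeEvent (hX : ∀ n, Measurable (X n)) (r : ℝ) (p : ℕ × ℕ) :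
    MeasurableSet (closeEvent X r p) :=
  measurableSet_le ((measurable_signedDoubling hX _).sub (measurable_signedDoubling hX _)).norm
    measurable_const

/-- The variable `X e` enters the first difference with a nonzero coefficient and is absent from the
second. Given the other variables, the first difference is therefore still uniform. -/
lemma measure_closeEvent_inter_of_notMem (hX : ∀ n, Measurable (X n)) (hindep : iIndepFun X μ)
    (hlaw : ∀ n, μ.map (X n) = volume) {p q : ℕ × ℕ} {e : ℕ} (hp : p.1 ≠ p.2)
    (he : p.1 / 2 = e ∨ p.2 / 2 = e) (hq : ¬ (q.1 / 2 = e ∨ q.2 / 2 = e)) (r r' : ℝ) :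
    μ (closeEvent X r p ∩ closeEvent X r' q) =
      ENNReal.ofReal (min 1 (2 * r)) * μ (closeEvent X r' q) := by
  classical
  obtain ⟨m, n⟩ := p
  obtain ⟨k, l⟩ := q
  simp only [not_or] at hp he hq
  set T : Finset ℕ := ({m / 2, n / 2, k / 2, l / 2} : Finset ℕ).erase e with hT
  have hdisj : Disjoint {e} T := by simp [hT]
  have hi := hindep.indepFun_finset {e} T hdisj hX
  set Z : Ω → (T → UnitAddCircle) := fun ω i => X i ω with hZdef
  have hZ : Measurable Z := measurable_pi_lambda _ fun i => hX i
  set c : ℤ := doublingCoeff e m - doublingCoeff e n with hc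
  have hc0 : c ≠ 0 := doublingCoeff_sub_ne_zero hp he
  set U : Ω → UnitAddCircle := fun ω => c • X e ω with hUdef
  have hU : Measurable U := (continuous_zsmul c).measurable.comp (hX e)
  have hUZ : IndepFun U Z μ :=
    hi.comp (φ := fun t : (({e} : Finset ℕ) → UnitAddCircle) =>
      c • t ⟨e, Finset.mem_singleton_self e⟩) (ψ := id)
      ((continuous_zsmul c).measurable.comp (measurable_pi_apply _)) measurable_id
  have hUlaw : μ.map U = volume :=
    ((Measure.measurePreserving_zsmul (volume : Measure UnitAddCircle) hc0).comp ⟨hX e, hlaw e⟩).map_eq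
  -- The value `0` off `T` matches `Function.update _ e 0`, as `e ∉ T`.
  let ext : ℕ → (T → UnitAddCircle) → UnitAddCircle := fun j t =>
    if h : j ∈ T then t ⟨j, h⟩ else 0
  have hext : ∀ j, Measurable (ext j) := by
    intro j
    by_cases h : j ∈ T
    · simp only [ext, h, dite_true]; exact measurable_pi_apply _
    · simp only [ext, h, dite_false]; exact measurable_const
  have hupd : ∀ ω a, a / 2 ∈ ({m / 2, n / 2, k / 2, l / 2} : Finset ℕ) →
      signedDoubling (Function.update (fun i => X i ω) e 0) a =
        signedDoubling (fun j => ext j (Z ω)) a := by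
    intro ω a ha
    apply signedDoubling_congr
    by_cases h : a / 2 = e
    · simp [ext, hT, h]
    · have : a / 2 ∈ T := by rw [hT]; exact Finset.mem_erase.2 ⟨h, ha⟩
      simp [ext, this, h, hZdef]
  have hE : closeEvent X r (m, n) = {ω | ‖U ω + (fun t : T → UnitAddCircle =>
      signedDoubling (fun j => ext j t) m - signedDoubling (fun j => ext j t) n) (Z ω)‖ ≤ r} := by
    ext ω
    simp only [closeEvent, Set.mem_ofPred_eq]
    rw [signedDoubling_eq_add_update _ e m, signedDoubling_eq_add_update _ e n,
      hupd ω m (by simp), hupd ω n (by simp), hUdef, hc]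
    simp only [sub_smul]
    rw [add_sub_add_comm]
  have hE' : closeEvent X r' (k, l) = Z ⁻¹' {t | ‖signedDoubling (fun j => ext j t) k -
      signedDoubling (fun j => ext j t) l‖ ≤ r'} := by
    ext ω
    simp only [closeEvent, Set.mem_ofPred_eq, Set.mem_preimage]
    rw [signedDoubling_eq_add_update _ e k, signedDoubling_eq_add_update _ e l,
      hupd ω k (by simp), hupd ω l (by simp)]
    simp [doublingCoeff, hq.1, hq.2]
  rw [hE, hE']
  refine measure_add_closedBall_inter hU hZ hUlaw hUZ
    ((measurable_signedDoubling hext m).sub (measurable_signedDoubling hext n)) ?_ r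
  exact measurableSet_le ((measurable_signedDoubling hext k).sub
    (measurable_signedDoubling hext l)).norm measurable_const

lemma measure_closeEvent (hX : ∀ n, Measurable (X n)) (hindep : iIndepFun X μ)
    (hlaw : ∀ n, μ.map (X n) = volume) {p : ℕ × ℕ} (hp : p.1 ≠ p.2) (r : ℝ) :
    μ (closeEvent X r p) = ENNReal.ofReal (min 1 (2 * r)) := by
  -- The degenerate pair `(j, j)` avoids block `p.1 / 2`, and its closeness event is the whole
  -- space.
  set j := 2 * (p.1 / 2 + 1)
  have h := measure_closeEvent_inter_of_notMem (q := (j, j)) hX hindep hlaw hp (Or.inl rfl)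
    (by simp only [j]; omega) r 0
  have h1 : closeEvent X 0 (j, j) = Set.univ := by
    ext ω; simp [closeEvent]
  simpa [h1] using h

lemma measure_closeEvent_inter (hX : ∀ n, Measurable (X n)) (hindep : iIndepFun X μ)
    (hlaw : ∀ n, μ.map (X n) = volume) {p q : ℕ × ℕ} (hp : p.1 ≠ p.2) (hq : q.1 ≠ q.2)
    (hpq : s(p.1 / 2, p.2 / 2) ≠ s(q.1 / 2, q.2 / 2)) (r : ℝ) :
    μ (closeEvent X r p ∩ closeEvent X r q) = μ (closeEvent X r p) * μ (closeEvent X r q) := by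
  -- Two distinct unordered pairs of blocks: one contains a block missing from the other.
  have key : (∃ e, (p.1 / 2 = e ∨ p.2 / 2 = e) ∧ ¬ (q.1 / 2 = e ∨ q.2 / 2 = e)) ∨
      (∃ e, (q.1 / 2 = e ∨ q.2 / 2 = e) ∧ ¬ (p.1 / 2 = e ∨ p.2 / 2 = e)) := by
    by_contra! h
    apply hpq
    have h1 := h.1 _ (Or.inl rfl)
    have h2 := h.1 _ (Or.inr rfl)
    have h3 := h.2 _ (Or.inl rfl)
    have h4 := h.2 _ (Or.inr rfl)
    rw [Sym2.eq_iff]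
    omega
  rcases key with ⟨e, h1, h2⟩ | ⟨e, h1, h2⟩
  · rw [measure_closeEvent_inter_of_notMem hX hindep hlaw hp h1 h2,
      measure_closeEvent hX hindep hlaw hp]
  · rw [Set.inter_comm, measure_closeEvent_inter_of_notMem hX hindep hlaw hq h1 h2,
      measure_closeEvent hX hindep hlaw hq, mul_comm]

end

/-! ### Second moments, almost sure convergence and interpolation -/

/-- The second moment of a centred sum of indicators of equiprobable events, each of which is
uncorrelated with all but at most `K` of the others. -/
lemma integral_sq_sum_indicator_sub_le {Ω ι : Type*} [MeasurableSpace Ω] {μ : Measure Ω}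
    [IsProbabilityMeasure μ] (s : Finset ι) {E : ι → Set Ω} (hE : ∀ i, MeasurableSet (E i))
    {c : ℝ} (hc : ∀ i ∈ s, μ.real (E i) = c) (K : ℕ)
    (hK : ∀ i ∈ s, ∃ t : Finset ι, t.card ≤ K ∧
      ∀ j ∈ s, j ∉ t → μ.real (E i ∩ E j) = c * c) :
    ∫ ω, (∑ i ∈ s, (E i).indicator (fun _ => (1 : ℝ)) ω - s.card * c) ^ 2 ∂μ ≤ s.card * (K * c) := by
  classical
  have hexp : ∀ ω, (∑ i ∈ s, (E i).indicator (fun _ => (1 : ℝ)) ω - s.card * c) ^ 2 =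
      ∑ i ∈ s, ∑ j ∈ s, ((E i ∩ E j).indicator (fun _ => (1 : ℝ)) ω
        - c * (E i).indicator (fun _ => (1 : ℝ)) ω - c * (E j).indicator (fun _ => (1 : ℝ)) ω
        + c * c) := by
    intro ω
    have h : ∑ i ∈ s, (E i).indicator (fun _ => (1 : ℝ)) ω - s.card * c =
        ∑ i ∈ s, ((E i).indicator (fun _ => (1 : ℝ)) ω - c) := by
      rw [Finset.sum_sub_distrib, Finset.sum_const, nsmul_eq_mul]
    rw [h, sq, Finset.sum_mul_sum]
    refine Finset.sum_congr rfl fun i _ => Finset.sum_congr rfl fun j _ => ?_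
    have h1 : (E i ∩ E j).indicator (fun _ => (1 : ℝ)) ω =
        (E i).indicator (fun _ => (1 : ℝ)) ω * (E j).indicator (fun _ => (1 : ℝ)) ω := by
      by_cases hi : ω ∈ E i <;> by_cases hj : ω ∈ E j <;> simp [hi, hj]
    rw [h1]
    ring
  have hint : ∀ A : Set Ω, MeasurableSet A →
      Integrable (A.indicator (fun _ => (1 : ℝ))) μ := fun A hA =>
    (integrable_const 1).indicator hA
  have hint1 : ∀ A, MeasurableSet A → ∫ ω, A.indicator (fun _ => (1 : ℝ)) ω ∂μ = μ.real A := by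
    intro A hA
    rw [integral_indicator_const _ hA]
    simp
  simp_rw [hexp]
  have hI : ∀ i j, Integrable (fun ω => (E i ∩ E j).indicator (fun _ => (1 : ℝ)) ω
        - c * (E i).indicator (fun _ => (1 : ℝ)) ω - c * (E j).indicator (fun _ => (1 : ℝ)) ω
        + c * c) μ := fun i j =>
    (((hint _ ((hE i).inter (hE j))).sub ((hint _ (hE i)).const_mul c)).sub
      ((hint _ (hE j)).const_mul c)).add (integrable_const _)
  have hval : ∀ i ∈ s, ∀ j ∈ s, ∫ ω, ((E i ∩ E j).indicator (fun _ => (1 : ℝ)) ω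
        - c * (E i).indicator (fun _ => (1 : ℝ)) ω - c * (E j).indicator (fun _ => (1 : ℝ)) ω
        + c * c) ∂μ = μ.real (E i ∩ E j) - c * c := by
    intro i hi j hj
    have hij := hint _ ((hE i).inter (hE j))
    have hci := (hint _ (hE i)).const_mul c
    have hcj := (hint _ (hE j)).const_mul c
    rw [integral_add (by exact (hij.sub hci).sub hcj) (integrable_const _),
      integral_sub (by exact hij.sub hci) hcj, integral_sub hij hci, integral_const_mul,
      integral_const_mul, hint1 _ ((hE i).inter (hE j)), hint1 _ (hE i), hint1 _ (hE j), hc i hi,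
      hc j hj]
    simp
  rw [integral_finsetSum _ fun i _ => integrable_finsetSum _ fun j _ => hI i j]
  rw [← nsmul_eq_mul]
  refine Finset.sum_le_card_nsmul _ _ _ fun i hi => ?_
  rw [integral_finsetSum _ fun j _ => hI i j, Finset.sum_congr rfl (hval i hi)]
  obtain ⟨t, htK, ht⟩ := hK i hi
  have hc0 : 0 ≤ c := hc i hi ▸ measureReal_nonneg
  calc ∑ j ∈ s, (μ.real (E i ∩ E j) - c * c) ≤ ∑ j ∈ s, (if j ∈ t then c else 0) := by
        refine Finset.sum_le_sum fun j hj => ?_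
        split_ifs with h
        · have h1 : μ.real (E i ∩ E j) ≤ c :=
            hc i hi ▸ measureReal_mono Set.inter_subset_left
          nlinarith
        · rw [ht j hj h, sub_self]
    _ = ((s.filter (· ∈ t)).card : ℝ) * c := by
        rw [← Finset.sum_filter, Finset.sum_const, nsmul_eq_mul]
    _ ≤ K * c := by
        gcongr
        refine (Finset.card_le_card ?_).trans htK
        intro j hj
        exact (Finset.mem_filter.1 hj).2

/-- A sequence of random variables with summable second moments tends to `0` almost surely. -/
lemma ae_tendsto_zero_of_integral_sq_le {Ω : Type*} [MeasurableSpace Ω] {μ : Measure Ω}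
    {Y : ℕ → Ω → ℝ} (hY : ∀ k, Measurable (Y k)) (hint : ∀ k, Integrable (fun ω => Y k ω ^ 2) μ)
    {b : ℕ → ℝ} (hb : Summable b) (hle : ∀ k, ∫ ω, Y k ω ^ 2 ∂μ ≤ b k) :
    ∀ᵐ ω ∂μ, Tendsto (fun k => Y k ω) atTop (𝓝 0) := by
  have hm : ∀ k, Measurable fun ω => ENNReal.ofReal (Y k ω ^ 2) := fun k =>
    ((hY k).pow_const 2).ennreal_ofReal
  have h1 : ∫⁻ ω, ∑' k, ENNReal.ofReal (Y k ω ^ 2) ∂μ ≠ ⊤ := by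
    rw [lintegral_tsum fun k => (hm k).aemeasurable]
    refine ne_top_of_le_ne_top hb.tsum_ofReal_ne_top (ENNReal.tsum_le_tsum fun k => ?_)
    rw [← ofReal_integral_eq_lintegral_ofReal (hint k) (ae_of_all _ fun ω => sq_nonneg _)]
    exact ENNReal.ofReal_le_ofReal (hle k)
  filter_upwards [ae_lt_top (Measurable.tsum hm) h1] with ω hω
  have h2 := ENNReal.tendsto_atTop_zero_of_tsum_ne_top hω.ne
  have h3 := (ENNReal.tendsto_toReal ENNReal.zero_ne_top).comp h2
  have h4 : Tendsto (fun k => Y k ω ^ 2) atTop (𝓝 0) := by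
    refine h3.congr fun k => ?_
    simp [sq_nonneg]
  have h5 := h4.sqrt
  simp only [Real.sqrt_sq_eq_abs, Real.sqrt_zero] at h5
  exact (tendsto_zero_iff_abs_tendsto_zero _).2 h5

/-- Interpolation from squares: for a function that is monotone in both arguments it suffices to
know the asymptotics along the squares, and at rational parameters. -/
lemma tendsto_div_of_tendsto_sq {F : ℕ → ℝ → ℝ} (hN : ∀ r, Monotone fun N => F N r)
    (hr : ∀ N, Monotone (F N)) (h0 : ∀ N r, 0 ≤ F N r)
    (h : ∀ q : ℚ, 0 < q → Tendsto (fun k : ℕ => F (k ^ 2) ((q : ℝ) / ((k ^ 2 : ℕ) : ℝ)) / ((k ^ 2 : ℕ) : ℝ))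
      atTop (𝓝 (2 * q))) {s : ℝ} (hs : 0 < s) :
    Tendsto (fun N : ℕ => F N (s / N) / N) atTop (𝓝 (2 * s)) := by
  have hsqrt : Tendsto Nat.sqrt atTop atTop :=
    tendsto_atTop_mono' _ (Eventually.of_forall fun _ => le_rfl) <|
      tendsto_atTop.2 fun b => by
        filter_upwards [eventually_ge_atTop (b * b)] with n hn
        exact Nat.le_sqrt.2 hn
  have hratio : Tendsto (fun k : ℕ => (((k + 1) ^ 2 : ℕ) : ℝ) / ((k ^ 2 : ℕ) : ℝ)) atTop (𝓝 1) := by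
    have h1 : Tendsto (fun k : ℕ => (1 + (k : ℝ)⁻¹) ^ 2) atTop (𝓝 1) := by
      simpa using ((tendsto_inv_atTop_nhds_zero_nat (𝕜 := ℝ)).const_add 1).pow 2
    refine h1.congr' ?_
    filter_upwards [eventually_gt_atTop 0] with k hk
    have : (k : ℝ) ≠ 0 := by positivity
    push_cast
    field_simp
  have hratio' : Tendsto (fun k : ℕ => ((k ^ 2 : ℕ) : ℝ) / (((k + 1) ^ 2 : ℕ) : ℝ)) atTop (𝓝 1) := by
    simpa using hratio.inv₀ one_ne_zero
  refine tendsto_order.2 ⟨fun a ha => ?_, fun a ha => ?_⟩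
  · rcases lt_or_ge a 0 with ha0 | ha0
    · exact Eventually.of_forall fun N => ha0.trans_le (div_nonneg (h0 _ _) (Nat.cast_nonneg _))
    obtain ⟨q, hq1, hq2⟩ := exists_rat_btwn (show a / 2 < s by linarith)
    have hq0 : (0 : ℝ) < q := by linarith
    have hlim : Tendsto (fun k : ℕ => F (k ^ 2) ((q : ℝ) / ((k ^ 2 : ℕ) : ℝ)) / ((k ^ 2 : ℕ) : ℝ) *
        (((k ^ 2 : ℕ) : ℝ) / (((k + 1) ^ 2 : ℕ) : ℝ))) atTop (𝓝 (2 * q)) := by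
      simpa using (h q (by exact_mod_cast hq0)).mul hratio'
    have h1 := (tendsto_order.1 hlim).1 a (by linarith)
    -- As `q < s`, eventually `q / k ^ 2 ≤ s / (k + 1) ^ 2 ≤ s / N`, so the radius at `k ^ 2` is the
    -- smaller one.
    have h2 := (tendsto_order.1 hratio').1 ((q : ℝ) / s) ((div_lt_one hs).2 hq2)
    filter_upwards [hsqrt.eventually h1, hsqrt.eventually h2,
      hsqrt.eventually (eventually_gt_atTop 0)] with N hN1 hN2 hN3
    set k := Nat.sqrt N
    have hk1 : k ^ 2 ≤ N := Nat.sqrt_le' N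
    have hk2 : N ≤ (k + 1) ^ 2 := (Nat.lt_succ_sqrt' N).le
    have hkR : (0 : ℝ) < ((k ^ 2 : ℕ) : ℝ) := by positivity
    have hk1R : ((k ^ 2 : ℕ) : ℝ) ≤ N := by exact_mod_cast hk1
    have hk2R : (N : ℝ) ≤ (((k + 1) ^ 2 : ℕ) : ℝ) := by exact_mod_cast hk2
    have hNR : (0 : ℝ) < N := hkR.trans_le hk1R
    have hle : (q : ℝ) / ((k ^ 2 : ℕ) : ℝ) ≤ s / N := by
      have hKR := hNR.trans_le hk2R
      rw [div_lt_div_iff₀ hs hKR] at hN2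
      rw [div_le_div_iff₀ hkR hNR]
      nlinarith
    refine hN1.trans_le ?_
    rw [div_mul_div_cancel₀ hkR.ne']
    exact div_le_div₀ (h0 _ _) ((hr _ hle).trans (hN _ hk1)) hNR hk2R
  · obtain ⟨q, hq1, hq2⟩ := exists_rat_btwn (show s < a / 2 by linarith)
    have hq0 : (0 : ℝ) < q := hs.trans hq1
    have hlim : Tendsto (fun k : ℕ => F ((k + 1) ^ 2) ((q : ℝ) / (((k + 1) ^ 2 : ℕ) : ℝ)) /
        (((k + 1) ^ 2 : ℕ) : ℝ) *
        ((((k + 1) ^ 2 : ℕ) : ℝ) / ((k ^ 2 : ℕ) : ℝ))) atTop (𝓝 (2 * q)) := by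
      simpa only [mul_one, Function.comp_def] using
        ((h q (by exact_mod_cast hq0)).comp (tendsto_add_atTop_nat 1)).mul hratio
    have h1 := (tendsto_order.1 hlim).2 a (by linarith)
    have h2 := (tendsto_order.1 hratio).2 ((q : ℝ) / s) ((one_lt_div hs).2 hq1)
    filter_upwards [hsqrt.eventually h1, hsqrt.eventually h2,
      hsqrt.eventually (eventually_gt_atTop 0)] with N hN1 hN2 hN3
    set k := Nat.sqrt N
    have hk1 : k ^ 2 ≤ N := Nat.sqrt_le' N
    have hk2 : N ≤ (k + 1) ^ 2 := (Nat.lt_succ_sqrt' N).le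
    have hkR : (0 : ℝ) < ((k ^ 2 : ℕ) : ℝ) := by positivity
    have hk1R : ((k ^ 2 : ℕ) : ℝ) ≤ N := by exact_mod_cast hk1
    have hk2R : (N : ℝ) ≤ (((k + 1) ^ 2 : ℕ) : ℝ) := by exact_mod_cast hk2
    have hNR : (0 : ℝ) < N := hkR.trans_le hk1R
    have hKR := hNR.trans_le hk2R
    have hle : s / N ≤ (q : ℝ) / (((k + 1) ^ 2 : ℕ) : ℝ) := by
      rw [div_lt_div_iff₀ hkR hs] at hN2
      rw [div_le_div_iff₀ hNR hKR]
      nlinarith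
    refine lt_of_le_of_lt ?_ hN1
    rw [div_mul_div_cancel₀ hKR.ne']
    exact div_le_div₀ (h0 _ _) ((hr _ hle).trans (hN _ hk2)) hkR hk1R

/-! ### Pair correlation of the random sequence -/

section
variable {Ω : Type*} {X : ℕ → Ω → UnitAddCircle}

/-- The number of ordered pairs of `r`-close terms among the first `N` ones. -/
noncomputable def closePairCount (X : ℕ → Ω → UnitAddCircle) (ω : Ω) (N : ℕ) (r : ℝ) : ℝ :=
  ∑ p ∈ (Finset.range N).offDiag, (closeEvent X r p).indicator (fun _ => (1 : ℝ)) ω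

lemma closePairCount_eq_ncard (ω : Ω) (N : ℕ) (r : ℝ) :
    closePairCount X ω N r = (({p : Fin N × Fin N | p.1 ≠ p.2 ∧
      ‖signedDoubling (fun n => X n ω) p.1 - signedDoubling (fun n => X n ω) p.2‖ ≤ r}.ncard : ℕ)
        : ℝ) := by
  classical
  have hinj : Function.Injective (Prod.map (Fin.val : Fin N → ℕ) (Fin.val : Fin N → ℕ)) :=
    Fin.val_injective.prodMap Fin.val_injective
  rw [closePairCount, ← Set.ncard_image_of_injective _ hinj]
  simp only [Set.indicator_apply]
  rw [Finset.sum_boole, ← Set.ncard_coe_finset]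
  congr 2
  ext ⟨m, n⟩
  rw [Finset.mem_coe, Finset.mem_filter, Finset.mem_offDiag, Finset.mem_range, Finset.mem_range]
  simp only [closeEvent,
    Set.mem_ofPred_eq, Set.mem_image, Prod.exists, Prod.map_apply, Prod.mk.injEq]
  constructor
  · rintro ⟨⟨hm, hn, hmn⟩, h⟩
    exact ⟨⟨m, hm⟩, ⟨n, hn⟩, ⟨by simpa using hmn, h⟩, rfl, rfl⟩
  · rintro ⟨a, b, ⟨hab, h⟩, rfl, rfl⟩
    exact ⟨⟨a.2, b.2, fun h' => hab (Fin.ext h')⟩, h⟩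

lemma closePairCount_nonneg (ω : Ω) (N : ℕ) (r : ℝ) : 0 ≤ closePairCount X ω N r :=
  Finset.sum_nonneg fun _ _ => Set.indicator_nonneg (fun _ _ => zero_le_one) _

lemma closePairCount_mono_left (ω : Ω) (r : ℝ) : Monotone fun N => closePairCount X ω N r := by
  intro N N' h
  refine Finset.sum_le_sum_of_subset_of_nonneg (Finset.offDiag_mono (Finset.range_mono h)) ?_
  exact fun _ _ _ => Set.indicator_nonneg (fun _ _ => zero_le_one) _

lemma closePairCount_mono_right (ω : Ω) (N : ℕ) : Monotone (closePairCount X ω N) := by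
  intro r r' h
  refine Finset.sum_le_sum fun p _ => ?_
  exact Set.indicator_le_indicator_of_subset (fun ω' (h' : _ ≤ r) => h'.trans h)
    (fun _ => zero_le_one) _

/-- Each block holds two indices, so an ordered pair of blocks carries 4 index pairs; the two orders
give 8. -/
lemma exists_card_le_eight_of_sym2_eq (p : ℕ × ℕ) :
    ∃ t : Finset (ℕ × ℕ), t.card ≤ 8 ∧ ∀ q : ℕ × ℕ, q ∉ t →
      s(p.1 / 2, p.2 / 2) ≠ s(q.1 / 2, q.2 / 2) := by
  set a := p.1 / 2
  set b := p.2 / 2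
  let c : ℕ → Finset ℕ := fun a => {2 * a, 2 * a + 1}
  have hc : ∀ a, (c a).card ≤ 2 := fun a => Finset.card_le_two
  have hmem : ∀ n, n ∈ c (n / 2) := fun n => by simp [c]; omega
  refine ⟨c a ×ˢ c b ∪ c b ×ˢ c a, ?_, fun q hq h => hq ?_⟩
  · refine (Finset.card_union_le _ _).trans ?_
    rw [Finset.card_product, Finset.card_product]
    have := Nat.mul_le_mul (hc a) (hc b)
    have := Nat.mul_le_mul (hc b) (hc a)
    omega
  · rw [Sym2.eq_iff] at h
    rw [Finset.mem_union, Finset.mem_product, Finset.mem_product]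
    rcases h with ⟨h1, h2⟩ | ⟨h1, h2⟩
    · left; rw [h1, h2]; exact ⟨hmem _, hmem _⟩
    · right; rw [h1, h2]; exact ⟨hmem _, hmem _⟩

lemma closePairCount_le (ω : Ω) (N : ℕ) (r : ℝ) :
    closePairCount X ω N r ≤ ((Finset.range N).offDiag.card : ℝ) := by
  have h := Finset.sum_le_card_nsmul (Finset.range N).offDiag
    (fun p => (closeEvent X r p).indicator (fun _ => (1 : ℝ)) ω) 1
    fun p _ => Set.indicator_le_self' (fun _ _ => zero_le_one) _
  simpa [closePairCount] using h

variable [MeasurableSpace Ω] {μ : Measure Ω} [IsProbabilityMeasure μ]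

lemma measurable_closePairCount (hX : ∀ n, Measurable (X n)) (N : ℕ) (r : ℝ) :
    Measurable fun ω => closePairCount X ω N r :=
  Finset.measurable_sum _ fun p _ =>
    measurable_const.indicator (measurableSet_closeEvent hX r p)

lemma integral_sq_closePairCount_sub_le (hX : ∀ n, Measurable (X n)) (hindep : iIndepFun X μ)
    (hlaw : ∀ n, μ.map (X n) = volume) (N : ℕ) {r : ℝ} (hr : 0 ≤ r) :
    ∫ ω, (closePairCount X ω N r - (Finset.range N).offDiag.card * min 1 (2 * r)) ^ 2 ∂μ ≤
      (Finset.range N).offDiag.card * ((8 : ℕ) * min 1 (2 * r)) := by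
  have hc0 : 0 ≤ min 1 (2 * r) := by positivity
  have hp : ∀ p ∈ (Finset.range N).offDiag, μ.real (closeEvent X r p) = min 1 (2 * r) := by
    intro p hp
    rw [measureReal_def, measure_closeEvent hX hindep hlaw (Finset.mem_offDiag.1 hp).2.2,
      ENNReal.toReal_ofReal hc0]
  refine integral_sq_sum_indicator_sub_le _ (measurableSet_closeEvent hX r) hp 8 fun p hp' => ?_
  obtain ⟨t, ht, h⟩ := exists_card_le_eight_of_sym2_eq p
  refine ⟨t, ht, fun q hq hqt => ?_⟩
  rw [measureReal_def, measure_closeEvent_inter hX hindep hlaw (Finset.mem_offDiag.1 hp').2.2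
    (Finset.mem_offDiag.1 hq).2.2 (h q hqt), ENNReal.toReal_mul, ← measureReal_def,
    ← measureReal_def, hp p hp', hp q hq]

lemma ae_tendsto_closePairCount_sq (hX : ∀ n, Measurable (X n)) (hindep : iIndepFun X μ)
    (hlaw : ∀ n, μ.map (X n) = volume) {s : ℝ} (hs : 0 < s) :
    ∀ᵐ ω ∂μ, Tendsto (fun k : ℕ => closePairCount X ω (k ^ 2) (s / ((k ^ 2 : ℕ) : ℝ)) /
      ((k ^ 2 : ℕ) : ℝ)) atTop (𝓝 (2 * s)) := by
  set m : ℕ → ℝ := fun N => (Finset.range N).offDiag.card * min 1 (2 * (s / N)) with hm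
  have hmlim : Tendsto (fun N : ℕ => m N / N) atTop (𝓝 (2 * s)) := by
    have h1 : Tendsto (fun N : ℕ => 2 * s - 2 * s * (N : ℝ)⁻¹) atTop (𝓝 (2 * s)) := by
      simpa using ((tendsto_inv_atTop_nhds_zero_nat (𝕜 := ℝ)).const_mul (2 * s)).const_sub (2 * s)
    refine h1.congr' ?_
    filter_upwards [eventually_gt_atTop 0, (tendsto_natCast_atTop_atTop (R := ℝ)).eventually_ge_atTop
      (2 * s)] with N hN hNs
    have hN0 : (0 : ℝ) < N := by positivity
    have h2 : 2 * (s / N) ≤ 1 := by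
      rw [← mul_div_assoc, div_le_one hN0]; exact hNs
    simp only [hm]
    rw [min_eq_right h2, Finset.offDiag_card, Finset.card_range, Nat.cast_sub (Nat.le_mul_self N),
      Nat.cast_mul]
    field_simp
  have hsq : Tendsto (fun k : ℕ => k ^ 2) atTop atTop := tendsto_pow_atTop two_ne_zero
  set Y : ℕ → Ω → ℝ := fun k ω => (closePairCount X ω (k ^ 2) (s / ((k ^ 2 : ℕ) : ℝ)) - m (k ^ 2)) /
    ((k ^ 2 : ℕ) : ℝ) with hYdef
  have hY : ∀ k, Measurable (Y k) := fun k =>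
    ((measurable_closePairCount hX _ _).sub_const _).div_const _
  have hint : ∀ k, Integrable (fun ω => Y k ω ^ 2) μ := by
    intro k
    refine Integrable.of_bound ((hY k).pow_const 2).aestronglyMeasurable
      ((((Finset.range (k ^ 2)).offDiag.card + |m (k ^ 2)|) / ((k ^ 2 : ℕ) : ℝ)) ^ 2)
      (ae_of_all _ fun ω => ?_)
    rw [norm_pow, Real.norm_eq_abs]
    simp only [hYdef]
    rw [abs_div, Nat.abs_cast]
    gcongr
    refine (abs_sub _ _).trans ?_
    gcongr
    rw [abs_of_nonneg (closePairCount_nonneg _ _ _)]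
    exact closePairCount_le _ _ _
  -- The count has variance at most `(k ^ 2) ^ 2 * 8 * (2 * s / k ^ 2)`; dividing by `(k ^ 2) ^ 2`
  -- leaves `16 * s / k ^ 2`.
  have hb : Summable fun k : ℕ => 16 * s * (1 / (k : ℝ) ^ 2) :=
    (Real.summable_one_div_nat_pow.2 one_lt_two).mul_left _
  have hle : ∀ k, ∫ ω, Y k ω ^ 2 ∂μ ≤ 16 * s * (1 / (k : ℝ) ^ 2) := by
    intro k
    rcases Nat.eq_zero_or_pos k with rfl | hk
    · simp [hYdef]
    have hkR : (0 : ℝ) < ((k ^ 2 : ℕ) : ℝ) := by positivity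
    have h1 := integral_sq_closePairCount_sub_le hX hindep hlaw (k ^ 2)
      (r := s / ((k ^ 2 : ℕ) : ℝ)) (by positivity)
    have h2 : ((Finset.range (k ^ 2)).offDiag.card : ℝ) ≤ ((k ^ 2 : ℕ) : ℝ) ^ 2 := by
      rw [Finset.offDiag_card, Finset.card_range]
      exact_mod_cast (Nat.sub_le _ _).trans (sq (k ^ 2)).ge
    simp only [hYdef, div_pow, integral_div]
    rw [div_le_iff₀ (by positivity)]
    refine h1.trans ?_
    calc _ ≤ ((k ^ 2 : ℕ) : ℝ) ^ 2 * ((8 : ℕ) * (2 * (s / ((k ^ 2 : ℕ) : ℝ)))) := by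
          gcongr
          exact min_le_right _ _
      _ = _ := by push_cast; field_simp; norm_num
  filter_upwards [ae_tendsto_zero_of_integral_sq_le hY hint hb hle] with ω hω
  have h := hω.add (hmlim.comp hsq)
  rw [zero_add] at h
  refine h.congr fun k => ?_
  simp only [hYdef, Function.comp]
  rw [← add_div, sub_add_cancel]

lemma ae_hasPoissonianPairCorrelation_of_measurable (hX : ∀ n, Measurable (X n))
    (hindep : iIndepFun X μ) (hlaw : ∀ n, μ.map (X n) = volume) :
    ∀ᵐ ω ∂μ, HasPoissonianPairCorrelation (signedDoubling (fun n => X n ω)) := by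
  -- Restricting to rational parameters leaves countably many null sets.
  have h : ∀ᵐ ω ∂μ, ∀ q : ℚ, 0 < q →
      Tendsto (fun k : ℕ => closePairCount X ω (k ^ 2) ((q : ℝ) / ((k ^ 2 : ℕ) : ℝ)) /
        ((k ^ 2 : ℕ) : ℝ)) atTop (𝓝 (2 * q)) := by
    rw [ae_all_iff]
    intro q
    by_cases hq : 0 < q
    · filter_upwards [ae_tendsto_closePairCount_sq hX hindep hlaw (s := q)
        (by exact_mod_cast hq)] with ω hω _ using hω
    · exact ae_of_all _ fun ω h => absurd h hq
  filter_upwards [h] with ω hω s hs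
  refine (tendsto_div_of_tendsto_sq (closePairCount_mono_left ω) (closePairCount_mono_right ω)
    (closePairCount_nonneg ω) hω hs).congr fun N => ?_
  rw [closePairCount_eq_ncard, one_div, div_eq_inv_mul]

lemma ae_hasPoissonianPairCorrelation_signedDoubling (hindep : iIndepFun X μ)
    (hunif : ∀ n, HasLaw (X n) (volume : Measure UnitAddCircle) μ) :
    ∀ᵐ ω ∂μ, HasPoissonianPairCorrelation (signedDoubling (fun n => X n ω)) := by
  have hm : ∀ n, AEMeasurable (X n) μ := fun n => (hunif n).aemeasurable
  have hae : ∀ n, X n =ᵐ[μ] (hm n).mk := fun n => (hm n).ae_eq_mk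
  have h := ae_hasPoissonianPairCorrelation_of_measurable (X := fun n => (hm n).mk)
    (fun n => (hm n).measurable_mk) (hindep.congr hae)
    fun n => (Measure.map_congr (hae n)).symm.trans (hunif n).map_eq
  filter_upwards [h, ae_all_iff.2 hae] with ω hω hω'
  simpa only [hω'] using hω

end

/-! ### Failure for four-fold differences -/

/-- Two distinct blocks, each listed in either order, give `4 * M * (M - 1)` nontrivial zeros with
`M = N / 2`. -/
lemma le_ncard_multiDifference_eq_zero (x : ℕ → UnitAddCircle) {N : ℕ} (hN : N ≠ 3) :
    (N : ℝ) ^ 2 / 4 - (N : ℝ) / 2 ≤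
      (({p ∈ nontrivialIndexPairs 2 N | multiDifference (signedDoubling x) p = 0}.ncard : ℕ) : ℝ) := by
  classical
  set M := N / 2 with hM
  let a : Fin M → Fin N := fun i => ⟨2 * i, by omega⟩
  let b : Fin M → Fin N := fun i => ⟨2 * i + 1, by omega⟩
  let t : Fin M × Bool → (Fin 2 → Fin N) := fun i =>
    if i.2 then ![a i.1, b i.1] else ![b i.1, a i.1]
  let f : (Fin M × Fin M) × (Bool × Bool) → (Fin 2 → Fin N) × (Fin 2 → Fin N) := fun q =>
    (t (q.1.1, q.2.1), t (q.1.2, q.2.2))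
  have ht : Function.Injective t := by
    rintro ⟨i, u⟩ ⟨j, v⟩ h
    have h0 := congrArg Fin.val (congrFun h 0)
    cases u <;> cases v <;> simp [t, a, b] at h0 ⊢ <;> omega
  have hf : Function.Injective f := by
    rintro ⟨⟨i, j⟩, u, v⟩ ⟨⟨i', j'⟩, u', v'⟩ h
    obtain ⟨h1, h2⟩ := Prod.mk.inj h
    have h1 := ht h1
    have h2 := ht h2
    simp_all
  have hsum : ∀ i, ∑ j, signedDoubling x (t i j) = 0 := by
    rintro ⟨i, u⟩
    have h1 : (2 * (i : ℕ) + 1) / 2 = i := by omega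
    cases u <;> simp [t, a, b, Fin.sum_univ_two, signedDoubling, h1, Nat.add_mod]
  have hsub : (((Finset.univ : Finset (Fin M)).offDiag ×ˢ
      (Finset.univ : Finset (Bool × Bool))).image f : Set ((Fin 2 → Fin N) × (Fin 2 → Fin N))) ⊆
      {p ∈ nontrivialIndexPairs 2 N | multiDifference (signedDoubling x) p = 0} := by
    intro p hp
    simp only [Finset.coe_image, Set.mem_image, Finset.mem_coe, Finset.mem_product,
      Finset.mem_offDiag, Finset.mem_univ, true_and, and_true] at hp
    obtain ⟨⟨⟨i, j⟩, u, v⟩, hij, rfl⟩ := hp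
    refine ⟨fun h => hij ?_, by simp [multiDifference, f, hsum]⟩
    have hmem : a i ∈ Multiset.map (f ((i, j), u, v)).2 Finset.univ.val := by
      rw [← h]
      cases u <;> simp [f, t]
    cases v <;> simp [f, t, a, b] at hmem <;> ext <;> simp <;> omega
  have hcard := Set.ncard_le_ncard hsub (Set.toFinite _)
  rw [Set.ncard_coe_finset, Finset.card_image_of_injective _ hf, Finset.card_product,
    Finset.offDiag_card] at hcard
  simp only [Finset.card_univ, Fintype.card_fin, Fintype.card_prod, Fintype.card_bool] at hcard
  have hcard' : ((M * M - M : ℕ) : ℝ) * 4 ≤ (({p ∈ nontrivialIndexPairs 2 N |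
      multiDifference (signedDoubling x) p = 0}.ncard : ℕ) : ℝ) := by exact_mod_cast hcard
  refine le_trans ?_ hcard'
  rw [Nat.cast_sub (Nat.le_mul_self M), Nat.cast_mul]
  rcases Nat.even_or_odd' N with ⟨k, hk | hk⟩
  · have h1 : M = k := by omega
    have h2 : (N : ℝ) = 2 * k := by exact_mod_cast hk
    rw [h1, h2]
    have : (k : ℝ) ≤ k * k := by exact_mod_cast Nat.le_mul_self k
    nlinarith
  · have h1 : M = k := by omega
    have h2 : (N : ℝ) = 2 * k + 1 := by exact_mod_cast hk
    rw [h1, h2]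
    rcases Nat.eq_zero_or_pos k with rfl | hk0
    · norm_num
    -- `N ≠ 3` excludes `k = 1`, where the construction gives no zeros but the bound is `3 / 4`.
    · have : (2 : ℝ) ≤ k := by
        have : 2 ≤ k := by omega
        exact_mod_cast this
      nlinarith

lemma not_hasPoissonianCorrelationOfDifferences_signedDoubling (x : ℕ → UnitAddCircle) :
    ¬ HasPoissonianCorrelationOfDifferences 2 (signedDoubling x) := by
  intro h
  -- Any `s < 1 / 8` works: the limit `2 * s` would lie below the density `1 / 4` of exact zeros.
  have h1 := h (1 / 16) (by norm_num)
  have h2 : Tendsto (fun N : ℕ => 1 / 4 - (1 / 2 : ℝ) * (N : ℝ)⁻¹) atTop (𝓝 (1 / 4)) := by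
    simpa using (tendsto_inv_atTop_nhds_zero_nat (𝕜 := ℝ)).const_mul (1 / 2 : ℝ) |>.const_sub
      (1 / 4 : ℝ)
  have h3 : (1 / 4 : ℝ) ≤ 2 * (1 / 16) := by
    refine le_of_tendsto_of_tendsto h2 h1 ?_
    filter_upwards [eventually_ge_atTop 4] with N hN
    have hN0 : (0 : ℝ) < N := by exact_mod_cast (by omega : 0 < N)
    have hle := le_ncard_multiDifference_eq_zero x (N := N) (by omega)
    have hsub : {p ∈ nontrivialIndexPairs 2 N | multiDifference (signedDoubling x) p = 0} ⊆
        {p ∈ nontrivialIndexPairs 2 N |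
          ‖multiDifference (signedDoubling x) p‖ ≤ 1 / 16 / (N : ℝ) ^ 2} := by
      rintro p ⟨hp, hp0⟩
      refine ⟨hp, ?_⟩
      rw [hp0, norm_zero]
      positivity
    have hc : (({p ∈ nontrivialIndexPairs 2 N |
        multiDifference (signedDoubling x) p = 0}.ncard : ℕ) : ℝ) ≤ _ :=
      Nat.cast_le.2 (Set.ncard_le_ncard hsub (Set.toFinite _))
    calc 1 / 4 - (1 / 2 : ℝ) * (N : ℝ)⁻¹ = 1 / (N : ℝ) ^ 2 * ((N : ℝ) ^ 2 / 4 - (N : ℝ) / 2) := by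
          field_simp
      _ ≤ _ := by gcongr; exact hle.trans hc
  norm_num at h3

theorem mainTheorem7 {Ω : Type*} [MeasurableSpace Ω] (μ : Measure Ω) [IsProbabilityMeasure μ]
    (X : ℕ → Ω → UnitAddCircle)
    (hindep : iIndepFun X μ)
    (hunif : ∀ n, HasLaw (X n) (volume : Measure UnitAddCircle) μ) :
    (∀ᵐ ω ∂μ, HasPoissonianPairCorrelation (signedDoubling (fun n => X n ω))) ∧
    (∀ ω, ¬ HasPoissonianCorrelationOfDifferences 2 (signedDoubling (fun n => X n ω))) ∧
    (∀ ω, ∀ N : ℕ, N ≠ 3 →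
      (N : ℝ) ^ 2 / 4 - (N : ℝ) / 2 ≤
        (({p ∈ nontrivialIndexPairs 2 N |
          multiDifference (signedDoubling (fun n => X n ω)) p = 0}.ncard : ℕ) : ℝ)) :=
  ⟨ae_hasPoissonianPairCorrelation_signedDoubling hindep hunif,
    fun _ => not_hasPoissonianCorrelationOfDifferences_signedDoubling _,
    fun _ _ => le_ncard_multiDifference_eq_zero _⟩
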